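/- Let $|\cdot|$ and $\langle\cdot,\cdot\rangle$ be the Euclidean norm and inner product on $\mathbb{R}^n$, $B(x,r)$ the open ball and $\bar{\mathbb B}$ the closed unit ball. Let $F:\mathbb{R}^n\rightrightarrows\mathbb{R}^n$ be a multifunction, $\mathcal{K}\subset\mathbb{R}^n$ a closed set (the target), and put $$h(x,\zeta)=\min_{v\in F(x)}\langle v,\zeta\rangle,\qquad H(x,p)=\max_{v\in F(x)}\langle v,p\rangle .$$ Assumption (F): every $F(x)$ is nonempty, convex and compact; for each compact $C\subset\mathbb{R}^n$ there is $L>0$ with $F(x)\subset F(y)+L|y-x|\bar{\mathbb B}$ for all $x,y\in C$; and there is $\gamma>0$ with $|v|\le\gamma(1+|x|)$ for all $x\in\mathbb{R}^n$, $v\in F(x)$. Assumption (H): for every $r>0$, (H1) there is $c\ge 0$ such that for every unit vector $p$ the function $f=H(\cdot,p)$ is semiconvex on $B(0,r)$ with constant $c$, i.e. it is continuous there and $f(x+k)+f(x-k)-2f(x)\ge -c|k|^2$ whenever the segment $[x-k,x+k]$ lies in $B(0,r)$; (H2) $\nabla_pH(x,p)$ exists for all $p\neq0$ and is Lipschitz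 in $x$ on $B(0,r)$, uniformly in $p\in\mathbb{R}^n\setminus\{0\}$. A trajectory on $[0,\tau]$ starting at $x_0$ is an absolutely continuous $x:[0,\tau]\to\mathbb{R}^n$ with $x(0)=x_0$ and $\dot x(t)\in F(x(t))$ for a.e. $t\in[0,\tau]$. The minimum time function $\mathcal{T}:\mathbb{R}^n\to[0,+\infty]$ is $\mathcal{T}(x_0)=0$ for $x_0\in\mathcal{K}$, and for $x_0\notin\mathcal{K}$ it is the infimum of all $\tau>0$ for which some trajectory $x$ on $[0,\tau]$ starting at $x_0$ satisfies $x(\tau)\in\mathcal{K}$ ($+\infty$ if there is none). Let $\mathcal{R}=\{x:\mathcal{T}(x)<+\infty\}$. An optimal trajectory for $x_0\in\mathcal{R}$ is a trajectory on $[0,\mathcal{T}(x_0)]$ starting at $x_0$ whose value at time $\mathcal{T}(x_0)$ lies in $\mathcal{K}$. For a set $S$ in a Euclidean space and $z\in S$, the proximal normal cone $N^P_S(z)$ is the set of $v$ for which there is $\sigma\ge0$ with $\langle v,y-z\rangle\le\sigma|y-z|^2$ for all $y\in S$. With $\mathrm{epi}(\mathcal{T})=\{(y,\beta)\in\mathbb{R}^n\times\mathbb{R}:\beta\ge\mathcal{T}(y)\}$,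 the horizontal proximal subdifferential of $\mathcal{T}$ at $x\in\mathcal{R}$ is $$\partial^\infty\mathcal{T}(x)=\{v\in\mathbb{R}^n:(v,0)\in N^P_{\mathrm{epi}(\mathcal{T})}(x,\mathcal{T}(x))\}.$$ Finally, $\partial_xH(x,p)$ is Clarke's generalized gradient of $f=H(\cdot,p)$ at $x$, i.e. the convex hull of all limits $\lim_i\nabla f(y_i)$, where $y_i\to x$ and $f$ is differentiable at each $y_i$. **Statement.** Assume (F) and (H), and let $x_0\in\mathcal{R}\setminus\mathcal{K}$. Let $\bar x:[0,\mathcal{T}(x_0)]\to\mathbb{R}^n$ be an optimal trajectory for $x_0$ (so $\bar x(0)=x_0$) and let $\bar p:[0,\mathcal{T}(x_0)]\to\mathbb{R}^n$ be absolutely continuous and such that, for a.e. $s\in[0,\mathcal{T}(x_0)]$, the gradient $\nabla_pH(\bar x(s),\bar p(s))$ exists and $$\dot{\bar x}(s)=\nabla_pH(\bar x(s),\bar p(s)),\qquad -\dot{\bar p}(s)\in\partial_xH(\bar x(s),\bar p(s)).$$ If $-\bar p(0)\in\partial^\infty\mathcal{T}(x_0)$, then for all $t\in[0,\mathcal{T}(x_0)]$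 $$-\bar p(t)\in\partial^\infty\mathcal{T}(\bar x(t))\quad\text{and}\quad h(\bar x(t),-\bar p(t))=0 .$$ -/

import Mathlib

open Set Filter Topology MeasureTheory
open scoped NNReal Pointwise Gradient RealInnerProductSpace

namespace MinTime

/-! ### Nonsmooth analysis -/

/-- The proximal normal cone to `S` at `x` (empty when `x ∉ S`). -/
def proximalNormalCone {V : Type*} [NormedAddCommGroup V] [InnerProductSpace ℝ V]
    (S : Set V) (x : V) : Set V :=
  {v | x ∈ S ∧ ∃ σ : ℝ, 0 ≤ σ ∧ ∀ y ∈ S, ⟪v, y - x⟫ ≤ σ * ‖y - x‖ ^ 2}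

/-- The epigraph of an extended-real-valued function, as a subset of `V × ℝ` with its Euclidean
(that is, `ℓ²` product) structure. -/
def epigraph {V : Type*} (f : V → EReal) : Set (WithLp 2 (V × ℝ)) :=
  {z | f z.fst ≤ (z.snd : EReal)}

/-- The horizontal proximal subdifferential of `f` at `x`: the vectors `v` such that `(v, 0)` is a
proximal normal to the epigraph at `(x, f x)`; it is empty if `f x` is infinite. -/
def horizontalSubdiff {V : Type*} [NormedAddCommGroup V] [InnerProductSpace ℝ V]
    (f : V → EReal) (x : V) : Set V :=
  {v | f x ≠ ⊤ ∧ f x ≠ ⊥ ∧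
    WithLp.toLp 2 (v, (0 : ℝ)) ∈
      proximalNormalCone (epigraph f) (WithLp.toLp 2 (x, (f x).toReal))}

/-- Semiconvexity with constant `c` on `Ω`: `f` is continuous on `Ω` and
`f (x + k) + f (x - k) - 2 f x ≥ -c |k|²` whenever `[x - k, x + k] ⊆ Ω`. -/
def SemiconvexOn {V : Type*} [NormedAddCommGroup V] [InnerProductSpace ℝ V]
    (Ω : Set V) (c : ℝ) (f : V → ℝ) : Prop :=
  ContinuousOn f Ω ∧
    ∀ x k : V, segment ℝ (x - k) (x + k) ⊆ Ω →
      -(c * ‖k‖ ^ 2) ≤ f (x + k) + f (x - k) - 2 * f x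

variable {n : ℕ}

/-- Clarke's generalized gradient of a (locally Lipschitz) function on `ℝⁿ`: the convex hull of
the limits of gradients at points of differentiability converging to `x`. -/
noncomputable def clarkeGradient (f : EuclideanSpace ℝ (Fin n) → ℝ)
    (x : EuclideanSpace ℝ (Fin n)) : Set (EuclideanSpace ℝ (Fin n)) :=
  convexHull ℝ {v | ∃ y : ℕ → EuclideanSpace ℝ (Fin n),
    (∀ i, DifferentiableAt ℝ f (y i)) ∧ Tendsto y atTop (𝓝 x) ∧
      Tendsto (fun i => ∇ f (y i)) atTop (𝓝 v)}

/-! ### Differential inclusions and the minimum time function -/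

/-- Assumption (F): nonempty convex compact values, local Lipschitz continuity, linear growth. -/
structure AssumptionF
    (F : EuclideanSpace ℝ (Fin n) → Set (EuclideanSpace ℝ (Fin n))) : Prop where
  nonempty : ∀ x, (F x).Nonempty
  convex : ∀ x, Convex ℝ (F x)
  compact : ∀ x, IsCompact (F x)
  locally_lipschitz : ∀ C : Set (EuclideanSpace ℝ (Fin n)), IsCompact C →
    ∃ L : ℝ, 0 < L ∧ ∀ x ∈ C, ∀ y ∈ C, F x ⊆ F y + Metric.closedBall 0 (L * ‖y - x‖)
  growth : ∃ γ : ℝ, 0 < γ ∧ ∀ x, ∀ v ∈ F x, ‖v‖ ≤ γ * (1 + ‖x‖)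

/-- `x` is a trajectory on `[0, τ]` of the differential inclusion `ẋ ∈ F(x)` starting at `x₀`
(only the values of `x` on `[0, τ]` matter). -/
def IsTrajectory (F : EuclideanSpace ℝ (Fin n) → Set (EuclideanSpace ℝ (Fin n))) (τ : ℝ)
    (x₀ : EuclideanSpace ℝ (Fin n)) (x : ℝ → EuclideanSpace ℝ (Fin n)) : Prop :=
  AbsolutelyContinuousOnInterval x 0 τ ∧ x 0 = x₀ ∧
    ∀ᵐ t ∂(volume.restrict (Icc 0 τ)), ∃ v ∈ F (x t), HasDerivAt x v t

open Classical in
/-- The minimum time function for the target `K`; it is `⊤` where `K` cannot be reached. -/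
noncomputable def minTime (F : EuclideanSpace ℝ (Fin n) → Set (EuclideanSpace ℝ (Fin n)))
    (K : Set (EuclideanSpace ℝ (Fin n))) (x₀ : EuclideanSpace ℝ (Fin n)) : EReal :=
  if x₀ ∈ K then 0
  else sInf {s : EReal | ∃ τ : ℝ, s = (τ : EReal) ∧ 0 < τ ∧
    ∃ x : ℝ → EuclideanSpace ℝ (Fin n), IsTrajectory F τ x₀ x ∧ x τ ∈ K}

/-- The reachable set: the points of finite minimum time. -/
def reachable (F : EuclideanSpace ℝ (Fin n) → Set (EuclideanSpace ℝ (Fin n)))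
    (K : Set (EuclideanSpace ℝ (Fin n))) : Set (EuclideanSpace ℝ (Fin n)) :=
  {x | minTime F K x < ⊤}

/-- `x` is an optimal trajectory for `x₀`: it starts at `x₀` and is in the target at the minimum
time (used for `x₀` in the reachable set). -/
def IsOptimalTrajectory (F : EuclideanSpace ℝ (Fin n) → Set (EuclideanSpace ℝ (Fin n)))
    (K : Set (EuclideanSpace ℝ (Fin n))) (x₀ : EuclideanSpace ℝ (Fin n))
    (x : ℝ → EuclideanSpace ℝ (Fin n)) : Prop :=
  IsTrajectory F (minTime F K x₀).toReal x₀ x ∧ x (minTime F K x₀).toReal ∈ K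

/-! ### Hamiltonians -/

/-- The minimized Hamiltonian `h(x, ζ) = min_{v ∈ F(x)} ⟨v, ζ⟩`. -/
noncomputable def minHam (F : EuclideanSpace ℝ (Fin n) → Set (EuclideanSpace ℝ (Fin n)))
    (x ζ : EuclideanSpace ℝ (Fin n)) : ℝ :=
  sInf ((fun v => ⟪v, ζ⟫) '' F x)

/-- The maximized Hamiltonian `H(x, p) = max_{v ∈ F(x)} ⟨v, p⟩`. -/
noncomputable def maxHam (F : EuclideanSpace ℝ (Fin n) → Set (EuclideanSpace ℝ (Fin n)))
    (x p : EuclideanSpace ℝ (Fin n)) : ℝ :=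
  sSup ((fun v => ⟪v, p⟫) '' F x)

/-- Assumption (H), for every `r > 0`: on the ball `B(0, r)` the functions `H(·, p)`, `|p| = 1`,
are semiconvex with a common constant, and `∇_p H(x, p)` exists for `p ≠ 0` and is Lipschitz in
`x`, uniformly in `p ≠ 0`. -/
structure AssumptionH
    (F : EuclideanSpace ℝ (Fin n) → Set (EuclideanSpace ℝ (Fin n))) : Prop where
  semiconvex : ∀ r : ℝ, 0 < r → ∃ c : ℝ, 0 ≤ c ∧ ∀ p : EuclideanSpace ℝ (Fin n), ‖p‖ = 1 →
    SemiconvexOn (Metric.ball 0 r) c (fun x => maxHam F x p)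
  gradient_exists : ∀ x p : EuclideanSpace ℝ (Fin n), p ≠ 0 →
    DifferentiableAt ℝ (fun q => maxHam F x q) p
  gradient_lipschitz : ∀ r : ℝ, 0 < r → ∃ L : ℝ≥0, ∀ p : EuclideanSpace ℝ (Fin n), p ≠ 0 →
    LipschitzOnWith L (fun x => ∇ (fun q => maxHam F x q) p) (Metric.ball 0 r)

/-- `(x, p)` solves the Hamiltonian inclusion `ẋ = ∇_p H(x, p)`, `-ṗ ∈ ∂_x H(x, p)` a.e. on
`[0, τ]`, where `∂_x` is Clarke's partial generalized gradient and the gradient `∇_p H(x, p)` is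
required to exist. -/
def IsHamiltonianArc (F : EuclideanSpace ℝ (Fin n) → Set (EuclideanSpace ℝ (Fin n))) (τ : ℝ)
    (x p : ℝ → EuclideanSpace ℝ (Fin n)) : Prop :=
  AbsolutelyContinuousOnInterval x 0 τ ∧ AbsolutelyContinuousOnInterval p 0 τ ∧
    ∀ᵐ t ∂(volume.restrict (Icc 0 τ)), ∃ v w : EuclideanSpace ℝ (Fin n),
      HasDerivAt x v t ∧ HasDerivAt p w t ∧
      HasGradientAt (fun q => maxHam F (x t) q) v (p t) ∧
      -w ∈ clarkeGradient (fun y => maxHam F y (p t)) (x t)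

end MinTime

namespace MinTime

/-! ### Absolutely continuous functions -/

section AbsolutelyContinuous

variable {X : Type*} [PseudoMetricSpace X]
variable {V : Type*} [NormedAddCommGroup V] [InnerProductSpace ℝ V]

/-! Write `T` for the minimum time at `x₀`. The proximal inequality at `x₀` is transported to `x t`
by a backward flow. Given `y` near `x t`, solve `ẇ = ∇_p H(w, p(s))` on `[0, t]` with `w t = y`.
Since `∇_p H(·, p)` is Lipschitz and `x` solves the same equation, `w` is a trajectory with `|w - x|
≤ C |y - x t|`. By dynamic programming, `(y, β)` in the epigraph puts `(w 0, t + β)` in it, with the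
same time offset `(t + β) - T = β - (T - t)`; so the inequality at `x₀` applies to `w 0`.

It remains to compare the pairings at times `0` and `t`. Almost everywhere `d/ds ⟪-p, w - x⟫ = ⟪-ṗ,
w - x⟫ + H(x, p) - H(w, p)`, because both velocities maximize against `p`. As `-ṗ` is a Clarke
gradient of a semiconvex function, this is at most a multiple of `|w - x|²`, so the pairing grows
only quadratically (`exists_backward_trajectory`, `neg_mem_horizontalSubdiff`). Where `p t = 0` the
claim is trivial; otherwise `p` has no zero on `[0, t]`, since zeros of `p` propagate forward.

For the Hamiltonian, test the proximal inequality at `x t` along the optimal trajectory itself,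
where the minimum time is `T - s`. The right side is quadratic in `s - t`, so `⟪p t, ẋ t⟫ = 0`, that
is, `H = 0`, at almost every time, and by continuity always. -/

lemma absolutelyContinuous_comp_monotone {f : ℝ → X} {g : ℝ → ℝ} {a b c d : ℝ}
    (hf : AbsolutelyContinuousOnInterval f a b) (hg : Monotone g)
    (hg' : ∀ s t, dist (g s) (g t) ≤ dist s t) (hm : MapsTo g (uIcc c d) (uIcc a b)) :
    AbsolutelyContinuousOnInterval (fun s => f (g s)) c d := by
  rw [absolutelyContinuousOnInterval_iff] at hf ⊢
  intro ε hε
  obtain ⟨δ, hδ, H⟩ := hf ε hε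
  refine ⟨δ, hδ, fun E hE hlen => ?_⟩
  refine H (E.1, fun i => (g (E.2 i).1, g (E.2 i).2)) ⟨fun i hi => ?_, ?_⟩ ?_
  · exact ⟨hm (hE.1 i hi).1, hm (hE.1 i hi).2⟩
  · intro i hi j hj hij
    have h := hE.2 hi hj hij
    -- Disjointness of half-open intervals is an order relation between their endpoints, so a
    -- monotone map preserves it even without injectivity.
    simp only [Function.onFun, uIoc, Set.Ioc_disjoint_Ioc] at h ⊢
    rw [← hg.map_min, ← hg.map_max, ← hg.map_min, ← hg.map_max, ← hg.map_min, ← hg.map_max]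
    exact hg h
  · exact (Finset.sum_le_sum fun i _ => hg' _ _).trans_lt hlen

lemma absolutelyContinuous_const (v : X) (a b : ℝ) :
    AbsolutelyContinuousOnInterval (fun _ : ℝ => v) a b := by
  simp [absolutelyContinuousOnInterval_iff]
  exact fun ε hε => ⟨1, one_pos, fun _ _ _ _ => hε⟩

lemma absolutelyContinuous_inner {u v : ℝ → V} {a b : ℝ}
    (hu : AbsolutelyContinuousOnInterval u a b) (hv : AbsolutelyContinuousOnInterval v a b) :
    AbsolutelyContinuousOnInterval (fun s => ⟪u s, v s⟫) a b := by
  obtain ⟨C, hC⟩ := hu.exists_bound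
  obtain ⟨D, hD⟩ := hv.exists_bound
  unfold AbsolutelyContinuousOnInterval at hu hv
  apply squeeze_zero' ?_ ?_ (by simpa using (hv.const_mul C).add (hu.const_mul D))
  · exact Filter.Eventually.of_forall fun _ => Finset.sum_nonneg (fun i hi => dist_nonneg)
  rw [eventually_inf_principal]
  filter_upwards with E hE
  simp only [Finset.mul_sum, ← Finset.sum_add_distrib]
  refine Finset.sum_le_sum fun i hi => ?_
  have h1 := hC _ (hE.1 i hi).1
  have h2 := hD _ (hE.1 i hi).2
  have e : ⟪u (E.2 i).1, v (E.2 i).1⟫ - ⟪u (E.2 i).2, v (E.2 i).2⟫ =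
      ⟪u (E.2 i).1, v (E.2 i).1 - v (E.2 i).2⟫ + ⟪u (E.2 i).1 - u (E.2 i).2, v (E.2 i).2⟫ := by
    rw [inner_sub_right, inner_sub_left]; ring
  rw [Real.dist_eq, e, dist_eq_norm, dist_eq_norm]
  refine (abs_add_le _ _).trans (add_le_add ?_ ?_)
  · exact (abs_real_inner_le_norm _ _).trans (by gcongr)
  · refine (abs_real_inner_le_norm _ _).trans ?_
    rw [mul_comm]; gcongr

lemma absolutelyContinuous_sub_le {φ : ℝ → ℝ} {a b M : ℝ} (hab : a ≤ b)
    (hφ : AbsolutelyContinuousOnInterval φ a b)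
    (h : ∀ᵐ s ∂(volume.restrict (Icc a b)), ∃ d, HasDerivAt φ d s ∧ d ≤ M) :
    φ b - φ a ≤ M * (b - a) := by
  rw [← hφ.integral_deriv_eq_sub]
  have : ∫ _ in a..b, M = M * (b - a) := by simp [mul_comm]
  rw [← this]
  refine intervalIntegral.integral_mono_ae_restrict hab hφ.intervalIntegrable_deriv (by simp) ?_
  filter_upwards [h] with s hs
  obtain ⟨d, hd, hdM⟩ := hs
  rwa [hd.deriv]

lemma absolutelyContinuous_exp_mul_norm_sq {u : ℝ → V} {a b : ℝ} (c : ℝ)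
    (hu : AbsolutelyContinuousOnInterval u a b) :
    AbsolutelyContinuousOnInterval (fun s => Real.exp (c * s) * ⟪u s, u s⟫) a b := by
  refine AbsolutelyContinuousOnInterval.fun_mul ?_ (absolutelyContinuous_inner hu hu)
  exact ContDiffOn.absolutelyContinuousOnInterval (by fun_prop)

lemma hasDerivAt_exp_mul_norm_sq {u : ℝ → V} {v : V} {s : ℝ} (c : ℝ) (hu : HasDerivAt u v s) :
    HasDerivAt (fun s => Real.exp (c * s) * ⟪u s, u s⟫)
      (Real.exp (c * s) * (c * ‖u s‖ ^ 2 + 2 * ⟪v, u s⟫)) s := by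
  have h1 : HasDerivAt (fun s => Real.exp (c * s)) (Real.exp (c * s) * (c * 1)) s :=
    ((hasDerivAt_id s).const_mul c).exp
  refine (h1.fun_mul (hu.inner ℝ hu)).congr_deriv ?_
  rw [real_inner_self_eq_norm_sq, real_inner_comm]
  ring

/-- Grönwall's inequality for absolutely continuous functions, in both time directions. -/
lemma absolutelyContinuous_gronwall {u : ℝ → V} {a b K : ℝ} (hab : a ≤ b)
    (hu : AbsolutelyContinuousOnInterval u a b)
    (h : ∀ᵐ s ∂(volume.restrict (Icc a b)), ∃ v, HasDerivAt u v s ∧ ‖v‖ ≤ K * ‖u s‖) :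
    ‖u b‖ ^ 2 ≤ Real.exp (2 * K * (b - a)) * ‖u a‖ ^ 2 ∧
      ‖u a‖ ^ 2 ≤ Real.exp (2 * K * (b - a)) * ‖u b‖ ^ 2 := by
  have key : ∀ s v, ‖v‖ ≤ K * ‖u s‖ → |⟪v, u s⟫| ≤ K * ‖u s‖ ^ 2 := fun s v hv =>
    (abs_real_inner_le_norm _ _).trans (by
      rw [pow_two, ← mul_assoc]; gcongr)
  constructor
  -- The weight `exp (-2Ks)` makes `‖u‖²` nonincreasing; the second half uses `exp (2Ks)` to make it
  -- nondecreasing.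
  · have := absolutelyContinuous_sub_le (M := 0) hab
      (absolutelyContinuous_exp_mul_norm_sq (-(2 * K)) hu) (by
        filter_upwards [h] with s ⟨v, hv, hvK⟩
        refine ⟨_, hasDerivAt_exp_mul_norm_sq _ hv, ?_⟩
        have := (abs_le.1 (key s v hvK)).2
        exact mul_nonpos_of_nonneg_of_nonpos (Real.exp_pos _).le (by linarith))
    simp only [real_inner_self_eq_norm_sq, zero_mul, sub_nonpos] at this
    have h2 := mul_le_mul_of_nonneg_left this (Real.exp_pos (2 * K * b)).le
    rw [← mul_assoc, ← mul_assoc, ← Real.exp_add, ← Real.exp_add] at h2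
    ring_nf at h2 ⊢
    simpa [mul_comm] using h2
  · have := absolutelyContinuous_sub_le (M := 0) hab
      ((absolutelyContinuous_exp_mul_norm_sq (2 * K) hu).fun_neg) (by
        filter_upwards [h] with s ⟨v, hv, hvK⟩
        refine ⟨_, (hasDerivAt_exp_mul_norm_sq _ hv).fun_neg, ?_⟩
        have := (abs_le.1 (key s v hvK)).1
        exact neg_nonpos.2 (mul_nonneg (Real.exp_pos _).le (by linarith)))
    simp only [real_inner_self_eq_norm_sq, zero_mul] at this
    have this : Real.exp (2 * K * a) * ‖u a‖ ^ 2 ≤ Real.exp (2 * K * b) * ‖u b‖ ^ 2 := by linarith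
    have h2 := mul_le_mul_of_nonneg_left this (Real.exp_pos (-(2 * K * a))).le
    rw [← mul_assoc, ← mul_assoc, ← Real.exp_add, ← Real.exp_add] at h2
    ring_nf at h2 ⊢
    simpa [mul_comm] using h2

end AbsolutelyContinuous

/-! ### The Hamiltonian -/

section Hamiltonian

variable {n : ℕ} {F : EuclideanSpace ℝ (Fin n) → Set (EuclideanSpace ℝ (Fin n))}

lemma AssumptionF.exists_inner_eq_maxHam (hF : AssumptionF F) (x p : EuclideanSpace ℝ (Fin n)) :
    ∃ v ∈ F x, ⟪v, p⟫ = maxHam F x p ∧ ∀ w ∈ F x, ⟪w, p⟫ ≤ maxHam F x p := by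
  obtain ⟨v, hv, hmax⟩ := (hF.compact x).exists_isMaxOn (f := fun v => ⟪v, p⟫) (hF.nonempty x)
    (by fun_prop)
  have h : IsGreatest ((fun v => ⟪v, p⟫) '' F x) ⟪v, p⟫ :=
    ⟨mem_image_of_mem _ hv, by rintro _ ⟨w, hw, rfl⟩; exact hmax hw⟩
  have e : ⟪v, p⟫ = maxHam F x p := h.csSup_eq.symm
  exact ⟨v, hv, e, fun w hw => e ▸ hmax hw⟩

lemma AssumptionF.inner_le_maxHam (hF : AssumptionF F) {x v : EuclideanSpace ℝ (Fin n)}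
    (hv : v ∈ F x) (p : EuclideanSpace ℝ (Fin n)) : ⟪v, p⟫ ≤ maxHam F x p :=
  (hF.exists_inner_eq_maxHam x p).choose_spec.2.2 v hv

lemma minHam_neg (F : EuclideanSpace ℝ (Fin n) → Set (EuclideanSpace ℝ (Fin n)))
    (x p : EuclideanSpace ℝ (Fin n)) : minHam F x (-p) = -maxHam F x p := by
  rw [minHam, maxHam, ← Real.sInf_neg]
  congr 1
  ext r
  simp [inner_neg_right, neg_eq_iff_eq_neg]

lemma maxHam_smul (F : EuclideanSpace ℝ (Fin n) → Set (EuclideanSpace ℝ (Fin n)))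
    (x p : EuclideanSpace ℝ (Fin n)) {c : ℝ} (hc : 0 ≤ c) :
    maxHam F x (c • p) = c * maxHam F x p := by
  rw [maxHam, maxHam, ← smul_eq_mul, ← Real.sSup_smul_of_nonneg hc]
  congr 1
  ext r
  simp [inner_smul_right, mem_smul_set]

/-- A maximizer is the gradient of the support function. -/
lemma AssumptionF.eq_of_hasGradientAt (hF : AssumptionF F) {x p v w : EuclideanSpace ℝ (Fin n)}
    (hv : HasGradientAt (fun q => maxHam F x q) v p) (hw : w ∈ F x)
    (hwp : ⟪w, p⟫ = maxHam F x p) : v = w := by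
  -- This difference is nonnegative everywhere and vanishes at `p`, so its derivative there is zero.
  have hmin : IsLocalMin (fun q => maxHam F x q - ⟪w, q⟫) p :=
    Eventually.of_forall fun q => by
      simpa [hwp] using hF.inner_le_maxHam hw q
  have hd : HasFDerivAt (fun q => maxHam F x q - ⟪w, q⟫)
      (InnerProductSpace.toDual ℝ _ v - InnerProductSpace.toDual ℝ _ w) p :=
    hv.hasFDerivAt.fun_sub (InnerProductSpace.toDual ℝ _ w).hasFDerivAt
  have := hmin.hasFDerivAt_eq_zero hd
  exact (InnerProductSpace.toDual ℝ _).injective (sub_eq_zero.1 this)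

lemma AssumptionF.gradient_mem (hF : AssumptionF F) {x p v : EuclideanSpace ℝ (Fin n)}
    (hv : HasGradientAt (fun q => maxHam F x q) v p) :
    v ∈ F x ∧ ⟪v, p⟫ = maxHam F x p := by
  obtain ⟨w, hw, hwp, -⟩ := hF.exists_inner_eq_maxHam x p
  rw [hF.eq_of_hasGradientAt hv hw hwp]
  exact ⟨hw, hwp⟩

lemma AssumptionF.maxHam_sub_le_of_growth (hF : AssumptionF F) {x : EuclideanSpace ℝ (Fin n)}
    {M : ℝ} (hM : ∀ v ∈ F x, ‖v‖ ≤ M) (p q : EuclideanSpace ℝ (Fin n)) :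
    |maxHam F x p - maxHam F x q| ≤ M * ‖p - q‖ := by
  have key : ∀ p q, maxHam F x p - maxHam F x q ≤ M * ‖p - q‖ := fun p q => by
    obtain ⟨v, hv, hvp, -⟩ := hF.exists_inner_eq_maxHam x p
    have h1 := hF.inner_le_maxHam hv q
    have h2 : ⟪v, p - q⟫ ≤ M * ‖p - q‖ :=
      (real_inner_le_norm _ _).trans (by gcongr; exact hM v hv)
    rw [inner_sub_right] at h2
    linarith
  have := key q p
  rw [norm_sub_rev] at this
  exact abs_le.2 ⟨by linarith, key p q⟩

lemma AssumptionF.exists_lipschitz_maxHam (hF : AssumptionF F) (r : ℝ) :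
    ∃ L : ℝ, 0 < L ∧ ∀ x ∈ Metric.ball 0 r, ∀ y ∈ Metric.ball 0 r, ∀ p,
      |maxHam F x p - maxHam F y p| ≤ L * ‖p‖ * ‖x - y‖ := by
  obtain ⟨L, hL, H⟩ := hF.locally_lipschitz (Metric.closedBall 0 r) (isCompact_closedBall 0 r)
  have key : ∀ x ∈ Metric.ball 0 r, ∀ y ∈ Metric.ball 0 r, ∀ p,
      maxHam F x p - maxHam F y p ≤ L * ‖p‖ * ‖x - y‖ := fun x hx y hy p => by
    obtain ⟨v, hv, hvp, -⟩ := hF.exists_inner_eq_maxHam x p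
    obtain ⟨w, hw, e, he, rfl⟩ :=
      H x (Metric.ball_subset_closedBall hx) y (Metric.ball_subset_closedBall hy) hv
    rw [mem_closedBall_zero_iff, norm_sub_rev] at he
    have h1 := hF.inner_le_maxHam hw p
    have h2 : ⟪e, p⟫ ≤ L * ‖x - y‖ * ‖p‖ := (real_inner_le_norm _ _).trans (by gcongr)
    rw [← hvp, inner_add_left]
    linarith
  refine ⟨L, hL, fun x hx y hy p => abs_le.2 ⟨?_, key x hx y hy p⟩⟩
  have := key y hy x hx p
  rw [norm_sub_rev] at this
  linarith

lemma AssumptionF.continuous_maxHam (hF : AssumptionF F) :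
    Continuous fun z : EuclideanSpace ℝ (Fin n) × EuclideanSpace ℝ (Fin n) =>
      maxHam F z.1 z.2 := by
  rw [continuous_iff_continuousAt]
  rintro ⟨x, p⟩
  obtain ⟨L, hL, H⟩ := hF.exists_lipschitz_maxHam (‖x‖ + 1)
  obtain ⟨γ, hγ, hg⟩ := hF.growth
  rw [ContinuousAt, tendsto_iff_dist_tendsto_zero]
  have hlim : Tendsto (fun z : EuclideanSpace ℝ (Fin n) × EuclideanSpace ℝ (Fin n) =>
      L * ‖z.2‖ * ‖z.1 - x‖ + γ * (1 + ‖x‖) * ‖z.2 - p‖) (𝓝 (x, p)) (𝓝 0) := by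
    have : Continuous (fun z : EuclideanSpace ℝ (Fin n) × EuclideanSpace ℝ (Fin n) =>
      L * ‖z.2‖ * ‖z.1 - x‖ + γ * (1 + ‖x‖) * ‖z.2 - p‖) := by fun_prop
    simpa using this.tendsto (x, p)
  refine squeeze_zero' (Eventually.of_forall fun _ => dist_nonneg) ?_ hlim
  have hball : ∀ᶠ z : EuclideanSpace ℝ (Fin n) × EuclideanSpace ℝ (Fin n) in 𝓝 (x, p),
      z.1 ∈ Metric.ball 0 (‖x‖ + 1) :=
    continuous_fst.continuousAt.eventually_mem (Metric.isOpen_ball.mem_nhds (by simp))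
  filter_upwards [hball] with z hz
  have h1 := H z.1 hz x (by simp) z.2
  have h2 := hF.maxHam_sub_le_of_growth (hg x) z.2 p
  exact (dist_triangle _ (maxHam F x z.2) _).trans (add_le_add h1 h2)

lemma AssumptionH.hasGradientAt (hH : AssumptionH F) (x : EuclideanSpace ℝ (Fin n))
    {p : EuclideanSpace ℝ (Fin n)} (hp : p ≠ 0) :
    HasGradientAt (fun q => maxHam F x q) (∇ (fun q => maxHam F x q) p) p :=
  (hH.gradient_exists x p hp).hasGradientAt

/-- The gradients stay in the compact set `F x`, and any cluster point maximizes against `p`;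
differentiability makes that maximizer unique. This gives continuity in time of the backward vector
field. -/
lemma continuousOn_gradient_maxHam (hF : AssumptionF F) (hH : AssumptionH F)
    (x : EuclideanSpace ℝ (Fin n)) :
    ContinuousOn (∇ (fun q => maxHam F x q)) {0}ᶜ := by
  intro p hp
  refine (hF.compact x).tendsto_nhds_of_unique_mapClusterPt ?_ ?_
  · filter_upwards [self_mem_nhdsWithin] with q hq
    exact (hF.gradient_mem (hH.hasGradientAt x hq)).1
  · intro w hw hcl
    refine (hF.eq_of_hasGradientAt (hH.hasGradientAt x hp) hw ?_).symm
    obtain ⟨U, hU, hUw⟩ := mapClusterPt_iff_ultrafilter.1 hcl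
    have hUp : Tendsto id (U : Filter (EuclideanSpace ℝ (Fin n))) (𝓝 p) :=
      tendsto_id.mono_left (hU.trans nhdsWithin_le_nhds)
    have h1 := hUw.inner hUp (𝕜 := ℝ)
    have h2 : Tendsto (fun q => maxHam F x q) U (𝓝 (maxHam F x p)) :=
      ((hF.continuous_maxHam.comp (Continuous.prodMk_right x)).tendsto p).comp hUp
    refine tendsto_nhds_unique h1 (h2.congr' ?_)
    filter_upwards [hU self_mem_nhdsWithin] with q hq
    exact (hF.gradient_mem (hH.hasGradientAt x hq)).2.symm

end Hamiltonian

/-! ### Clarke's gradient of a semiconvex function -/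

section Semiconvex

variable {V : Type*} [NormedAddCommGroup V] [InnerProductSpace ℝ V] [CompleteSpace V]

/-- Repeated halving of `[z, y]` compares successive dyadic difference quotients at `z`. The errors
`c ‖d‖² / 4 · 2⁻ʲ` sum to `c ‖d‖² / 2`, and the quotients tend to the directional derivative. -/
lemma semiconvex_gradient_le {Ω : Set V} (hΩ : Convex ℝ Ω) {c : ℝ} {f : V → ℝ}
    (hf : SemiconvexOn Ω c f) {z y : V} (hz : z ∈ Ω) (hy : y ∈ Ω) (hd : DifferentiableAt ℝ f z) :
    f z + ⟪∇ f z, y - z⟫ - c / 2 * ‖y - z‖ ^ 2 ≤ f y := by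
  set d := y - z with hdd
  have hmem : ∀ s ∈ Icc (0 : ℝ) 1, z + s • d ∈ Ω := fun s hs => by
    rw [hdd, add_comm]
    exact hΩ.lineMap_mem hz hy hs
  have hhalf : ∀ s ∈ Icc (0 : ℝ) 1,
      2 * (f (z + (s / 2) • d) - f z) ≤ f (z + s • d) - f z + c * ‖d‖ ^ 2 * s ^ 2 / 4 := by
    intro s hs
    have e1 : z + (s / 2) • d - (s / 2) • d = z := by abel
    have e2 : z + (s / 2) • d + (s / 2) • d = z + s • d := by
      rw [add_assoc, ← add_smul]; ring_nf
    have := hf.2 (z + (s / 2) • d) ((s / 2) • d) (by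
      rw [e1, e2]; exact hΩ.segment_subset hz (hmem s hs))
    rw [e1, e2, norm_smul, mul_pow, Real.norm_eq_abs, sq_abs] at this
    linarith
  have hj : ∀ j : ℕ, (2 : ℝ) ^ j * (f (z + ((1 / 2 : ℝ) ^ j) • d) - f z) ≤
      f y - f z + c * ‖d‖ ^ 2 / 2 * (1 - (1 / 2) ^ j) := by
    intro j
    induction j with
    | zero => simp [hdd]
    | succ j ih =>
      have h := hhalf ((1 / 2) ^ j) ⟨by positivity, pow_le_one₀ (by norm_num) (by norm_num)⟩
      have e : ((1 : ℝ) / 2) ^ j / 2 = (1 / 2) ^ (j + 1) := by rw [pow_succ]; ring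
      rw [e] at h
      have h2 := mul_le_mul_of_nonneg_left h (show (0 : ℝ) ≤ 2 ^ j by positivity)
      have e3 : (2 : ℝ) ^ j * (1 / 2) ^ j = 1 := by rw [← mul_pow]; norm_num
      have e4 : (2 : ℝ) ^ j * (c * ‖d‖ ^ 2 * ((1 / 2) ^ j) ^ 2 / 4) =
          c * ‖d‖ ^ 2 / 4 * (1 / 2) ^ j := by
        linear_combination (c * ‖d‖ ^ 2 * (1 / 2) ^ j / 4) * e3
      rw [mul_add, e4] at h2
      rw [pow_succ (2 : ℝ), mul_assoc, pow_succ ((1 : ℝ) / 2)]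
      rw [pow_succ ((1 : ℝ) / 2)] at h2
      linarith
  have hlim : Tendsto (fun j : ℕ => (2 : ℝ) ^ j * (f (z + ((1 / 2 : ℝ) ^ j) • d) - f z)) atTop
      (𝓝 ⟪∇ f z, d⟫) := by
    have hline := hd.hasGradientAt.hasFDerivAt.hasLineDerivAt d
    have hs : Tendsto (fun j : ℕ => (1 / 2 : ℝ) ^ j) atTop (𝓝[≠] 0) :=
      tendsto_nhdsWithin_iff.2 ⟨tendsto_pow_atTop_nhds_zero_of_lt_one (by norm_num) (by norm_num),
        Eventually.of_forall fun j => by simp⟩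
    have := (hasDerivAt_iff_tendsto_slope_zero.1 hline).comp hs
    simpa [Function.comp_def] using this
  have hlim2 : Tendsto (fun j : ℕ => f y - f z + c * ‖d‖ ^ 2 / 2 * (1 - (1 / 2 : ℝ) ^ j)) atTop
      (𝓝 (f y - f z + c * ‖d‖ ^ 2 / 2 * (1 - 0))) :=
    ((tendsto_pow_atTop_nhds_zero_of_lt_one (by norm_num) (by norm_num)).const_sub 1).const_mul _
      |>.const_add _
  have := le_of_tendsto_of_tendsto' hlim hlim2 hj
  linarith

variable {n : ℕ} {f : EuclideanSpace ℝ (Fin n) → ℝ}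

/-- For fixed `x` and `y` the inequality cuts out a half-space of `ξ`, so it survives convex hulls;
continuity of `f` carries it from the differentiability points to the limit. -/
lemma semiconvex_clarkeGradient_le {Ω : Set (EuclideanSpace ℝ (Fin n))} (hΩ : Convex ℝ Ω)
    (hΩo : IsOpen Ω) {c : ℝ} (hf : SemiconvexOn Ω c f) {x y ξ : EuclideanSpace ℝ (Fin n)}
    (hx : x ∈ Ω) (hy : y ∈ Ω) (hξ : ξ ∈ clarkeGradient f x) :
    f x + ⟪ξ, y - x⟫ - c / 2 * ‖y - x‖ ^ 2 ≤ f y := by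
  have hconv : Convex ℝ {ξ : EuclideanSpace ℝ (Fin n) |
      ⟪ξ, y - x⟫ ≤ f y - f x + c / 2 * ‖y - x‖ ^ 2} :=
    convex_halfSpace_le (f := fun ξ => ⟪ξ, y - x⟫)
      ⟨fun _ _ => inner_add_left _ _ _, fun _ _ => real_inner_smul_left _ _ _⟩ _
  have := convexHull_min (fun v hv => ?_) hconv hξ
  · simp only [mem_ofPred_eq] at this
    linarith
  obtain ⟨z, hz, hzx, hzv⟩ := hv
  have hfx : Tendsto (fun i => f (z i)) atTop (𝓝 (f x)) :=
    ((hf.1.continuousAt (hΩo.mem_nhds hx)).tendsto).comp hzx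
  have hyz : Tendsto (fun i => y - z i) atTop (𝓝 (y - x)) := hzx.const_sub y
  have hl := (hfx.add (hzv.inner hyz (𝕜 := ℝ))).sub ((hyz.norm.pow 2).const_mul (c / 2))
  have := le_of_tendsto hl (by
    filter_upwards [hzx.eventually_mem (hΩo.mem_nhds hx)] with i hi
    exact semiconvex_gradient_le hΩ hf hi hy (hz i))
  simp only [mem_ofPred_eq]
  linarith

lemma norm_le_of_mem_clarkeGradient {x ξ : EuclideanSpace ℝ (Fin n)} {C : ℝ} (hC : 0 ≤ C)
    {Ω : Set (EuclideanSpace ℝ (Fin n))} (hΩ : IsOpen Ω) (hx : x ∈ Ω)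
    (hf : ∀ y ∈ Ω, ∀ z ∈ Ω, |f y - f z| ≤ C * ‖y - z‖) (hξ : ξ ∈ clarkeGradient f x) :
    ‖ξ‖ ≤ C := by
  rw [← mem_closedBall_zero_iff]
  refine convexHull_min (fun v hv => ?_) (convex_closedBall _ _) hξ
  obtain ⟨z, hz, hzx, hzv⟩ := hv
  refine Metric.isClosed_closedBall.mem_of_tendsto hzv ?_
  filter_upwards [hzx.eventually_mem (hΩ.mem_nhds hx)] with i hi
  have h : ‖fderiv ℝ f (z i)‖ ≤ C := by
    refine norm_fderiv_le_of_lip' ℝ hC ?_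
    filter_upwards [hΩ.mem_nhds hi] with y hy using hf y hy _ hi
  rw [mem_closedBall_zero_iff]
  simpa [gradient] using h

/-- Positive homogeneity of `H` in `p` scales the unit-vector constant `c` to `c ‖p‖`. -/
lemma maxHam_clarkeGradient_le {F : EuclideanSpace ℝ (Fin n) → Set (EuclideanSpace ℝ (Fin n))}
    {r c : ℝ} (hc : ∀ p : EuclideanSpace ℝ (Fin n), ‖p‖ = 1 →
      SemiconvexOn (Metric.ball 0 r) c (fun x => maxHam F x p))
    {x y p ξ : EuclideanSpace ℝ (Fin n)} (hp : p ≠ 0) (hx : x ∈ Metric.ball 0 r)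
    (hy : y ∈ Metric.ball 0 r) (hξ : ξ ∈ clarkeGradient (fun z => maxHam F z p) x) :
    maxHam F x p + ⟪ξ, y - x⟫ - c * ‖p‖ / 2 * ‖y - x‖ ^ 2 ≤ maxHam F y p := by
  refine semiconvex_clarkeGradient_le (f := fun z => maxHam F z p) (c := c * ‖p‖)
    (convex_ball 0 r) Metric.isOpen_ball ?_ hx hy hξ
  have h := hc (‖p‖⁻¹ • p) (norm_smul_inv_norm (𝕜 := ℝ) hp)
  have e : ∀ z, maxHam F z p = ‖p‖ * maxHam F z (‖p‖⁻¹ • p) := fun z => by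
    rw [← maxHam_smul F _ _ (norm_nonneg p), smul_inv_smul₀ (norm_ne_zero_iff.2 hp)]
  simp only [e]
  refine ⟨continuousOn_const.mul h.1, fun z k hzk => ?_⟩
  have := mul_le_mul_of_nonneg_left (h.2 z k hzk) (norm_nonneg p)
  linarith

end Semiconvex

/-! ### Trajectories and the dynamic programming principle -/

section Trajectory

variable {n : ℕ} {F : EuclideanSpace ℝ (Fin n) → Set (EuclideanSpace ℝ (Fin n))}
  {K : Set (EuclideanSpace ℝ (Fin n))}

lemma ae_restrict_Icc_add {P : ℝ → Prop} {a b : ℝ} (t : ℝ)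
    (h : ∀ᵐ s ∂(volume.restrict (Icc a b)), P s) :
    ∀ᵐ s ∂(volume : Measure ℝ), s + t ∈ Icc a b → P (s + t) := by
  rw [ae_restrict_iff' measurableSet_Icc] at h
  exact (measurePreserving_add_right volume t).quasiMeasurePreserving.ae h

lemma IsTrajectory.restrict {T t : ℝ} {a : EuclideanSpace ℝ (Fin n)}
    {x : ℝ → EuclideanSpace ℝ (Fin n)} (hx : IsTrajectory F T a x) (ht : t ∈ Icc 0 T) :
    IsTrajectory F t a x := by
  have hsub : Icc 0 t ⊆ Icc 0 T := Icc_subset_Icc_right ht.2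
  refine ⟨hx.1.mono ?_, hx.2.1, ae_restrict_of_ae_restrict_of_subset hsub hx.2.2⟩
  rwa [uIcc_of_le ht.1, uIcc_of_le (ht.1.trans ht.2)]

lemma IsTrajectory.tail {T t : ℝ} {a : EuclideanSpace ℝ (Fin n)}
    {x : ℝ → EuclideanSpace ℝ (Fin n)} (hx : IsTrajectory F T a x) (ht : t ∈ Icc 0 T) :
    IsTrajectory F (T - t) (x t) (fun s => x (s + t)) := by
  refine ⟨?_, by simp, ?_⟩
  · refine absolutelyContinuous_comp_monotone hx.1 (fun r s h => by simpa using h)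
      (fun r s => by simp) ?_
    rw [uIcc_of_le (ht.1.trans ht.2), uIcc_of_le (sub_nonneg.2 ht.2)]
    exact fun s hs => ⟨by linarith [hs.1, ht.1], by linarith [hs.2]⟩
  · rw [ae_restrict_iff' measurableSet_Icc]
    filter_upwards [ae_restrict_Icc_add t hx.2.2] with s hs hst
    obtain ⟨v, hv, hd⟩ := hs ⟨by linarith [hst.1, ht.1], by linarith [hst.2]⟩
    exact ⟨v, hv, hd.comp_add_const s t⟩

/-- The formula freezes `y` after time `t` and `z` before it, then removes the common value;
absolute continuity follows from sums and monotone reparametrizations. -/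
lemma IsTrajectory.concat {t τ : ℝ} (ht : 0 ≤ t) (hτ : 0 ≤ τ) {a : EuclideanSpace ℝ (Fin n)}
    {y z : ℝ → EuclideanSpace ℝ (Fin n)} (hy : IsTrajectory F t a y)
    (hz : IsTrajectory F τ (y t) z) :
    IsTrajectory F (t + τ) a (fun s => y (min s t) + z (max (s - t) 0) - y t) := by
  have htτ : 0 ≤ t + τ := add_nonneg ht hτ
  refine ⟨?_, by simp [hz.2.1, hy.2.1, ht], ?_⟩
  · refine AbsolutelyContinuousOnInterval.fun_sub (AbsolutelyContinuousOnInterval.fun_add ?_ ?_)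
      (absolutelyContinuous_const _ _ _)
    · refine absolutelyContinuous_comp_monotone (g := fun s => min s t) hy.1
        (fun r s h => min_le_min_right t h) (fun r s => ?_) ?_
      · simpa [Real.dist_eq] using abs_min_sub_min_le_max r t s t
      · rw [uIcc_of_le htτ, uIcc_of_le ht]
        exact fun s hs => ⟨le_min hs.1 ht, min_le_right _ _⟩
    · refine absolutelyContinuous_comp_monotone (g := fun s => max (s - t) 0) hz.1
        (fun r s h => max_le_max_right 0 (by linarith)) (fun r s => ?_) ?_
      · simpa [Real.dist_eq] using abs_max_sub_max_le_max (r - t) 0 (s - t) 0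
      · rw [uIcc_of_le htτ, uIcc_of_le hτ]
        exact fun s hs => ⟨le_max_right _ _, max_le (by linarith [hs.2]) hτ⟩
  · have hy' := hy.2.2
    rw [ae_restrict_iff' measurableSet_Icc] at hy' ⊢
    have hne : ∀ᵐ s ∂(volume : Measure ℝ), s ≠ t := by simp [ae_iff, measure_singleton]
    filter_upwards [hy', ae_restrict_Icc_add (-t) hz.2.2, hne] with s h1 h2 h3 hs
    rcases lt_or_gt_of_ne h3 with hlt | hgt
    · obtain ⟨v, hv, hd⟩ := h1 ⟨hs.1, hlt.le⟩
      refine ⟨v, ?_, hd.congr_of_eventuallyEq ?_⟩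
      · simpa [hlt.le, hz.2.1] using hv
      · filter_upwards [Iio_mem_nhds hlt] with r hr
        have hr : r ≤ t := le_of_lt hr
        simp [hr, hz.2.1]
    · obtain ⟨v, hv, hd⟩ := h2 ⟨by linarith, by linarith [hs.2]⟩
      refine ⟨v, ?_, (hd.comp_add_const s (-t)).congr_of_eventuallyEq ?_⟩
      · simpa [hgt.le, sub_eq_add_neg] using hv
      · filter_upwards [Ioi_mem_nhds hgt] with r hr
        have hr : t ≤ r := le_of_lt hr
        simp [hr, sub_eq_add_neg]

lemma minTime_nonneg (a : EuclideanSpace ℝ (Fin n)) : 0 ≤ minTime F K a := by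
  unfold minTime
  split_ifs
  · exact le_rfl
  · refine le_sInf ?_
    rintro _ ⟨τ, rfl, hτ, -⟩
    exact_mod_cast hτ.le

lemma minTime_le {τ : ℝ} (hτ : 0 ≤ τ) {a : EuclideanSpace ℝ (Fin n)}
    {w : ℝ → EuclideanSpace ℝ (Fin n)} (hw : IsTrajectory F τ a w) (hwK : w τ ∈ K) :
    minTime F K a ≤ τ := by
  unfold minTime
  split_ifs with ha
  · exact_mod_cast hτ
  · refine sInf_le ⟨τ, rfl, hτ.lt_of_ne ?_, w, hw, hwK⟩
    rintro rfl
    exact ha (hw.2.1 ▸ hwK)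

/-- The dynamic programming inequality. The infimum at `w t` need not be attained, so nearly optimal
continuations are concatenated, one for each `c > t + β`. -/
lemma minTime_le_add_of_le {t β : ℝ} (ht : 0 ≤ t) {a : EuclideanSpace ℝ (Fin n)}
    {w : ℝ → EuclideanSpace ℝ (Fin n)} (hw : IsTrajectory F t a w)
    (hβ : minTime F K (w t) ≤ β) : minTime F K a ≤ ((t + β : ℝ) : EReal) := by
  by_cases hK : w t ∈ K
  · refine (minTime_le ht hw hK).trans ?_
    have : (0 : EReal) ≤ β := (minTime_nonneg _).trans hβ
    have : (0 : ℝ) ≤ β := by exact_mod_cast this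
    exact_mod_cast (by linarith : t ≤ t + β)
  · refine EReal.le_of_forall_lt_iff_le.1 fun c hc => ?_
    have hlt : minTime F K (w t) < ((c - t : ℝ) : EReal) :=
      hβ.trans_lt (by
        have : t + β < c := by exact_mod_cast hc
        exact_mod_cast (by linarith : β < c - t))
    rw [minTime, if_neg hK, sInf_lt_iff] at hlt
    obtain ⟨_, ⟨τ, rfl, hτ, z, hz, hzK⟩, hτc⟩ := hlt
    have hτc : τ < c - t := by exact_mod_cast hτc
    refine (minTime_le (add_nonneg ht hτ.le) (hw.concat ht hτ.le hz) ?_).trans ?_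
    · simpa [hτ.le] using hzK
    · exact_mod_cast (by linarith : t + τ ≤ c)

lemma minTime_toReal {a : EuclideanSpace ℝ (Fin n)} (ha : a ∈ reachable F K) :
    (((minTime F K a).toReal : ℝ) : EReal) = minTime F K a :=
  EReal.coe_toReal (ne_of_lt ha) (ne_bot_of_le_ne_bot EReal.zero_ne_bot (minTime_nonneg a))

/-- The tail of `x` gives the upper bound; a faster continuation from `x t` would contradict
optimality at `a`. -/
lemma IsOptimalTrajectory.minTime_eq {a : EuclideanSpace ℝ (Fin n)} (ha : a ∈ reachable F K)
    {x : ℝ → EuclideanSpace ℝ (Fin n)} (hx : IsOptimalTrajectory F K a x) {t : ℝ}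
    (ht : t ∈ Icc 0 (minTime F K a).toReal) :
    minTime F K (x t) = (((minTime F K a).toReal - t : ℝ) : EReal) := by
  set T := (minTime F K a).toReal with hT
  have hle : minTime F K (x t) ≤ ((T - t : ℝ) : EReal) :=
    minTime_le (sub_nonneg.2 ht.2) (hx.1.tail ht) (by simpa using hx.2)
  refine le_antisymm hle (not_lt.1 fun hlt => ?_)
  obtain ⟨β, hβ⟩ : ∃ β : ℝ, minTime F K (x t) = β :=
    ⟨_, (minTime_toReal (hlt.trans (EReal.coe_lt_top _))).symm⟩
  have h := minTime_le_add_of_le ht.1 (hx.1.restrict ht) hβ.le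
  rw [← minTime_toReal ha, ← hT] at h
  rw [hβ] at hlt
  have h1 : T ≤ t + β := by exact_mod_cast h
  have h2 : β < T - t := by exact_mod_cast hlt
  linarith

end Trajectory

/-! ### Backward trajectories near a Hamiltonian arc -/

section Backward

variable {n : ℕ}

/-- The coordinatewise retraction of `ℝⁿ` onto the cube `[-R, R]ⁿ`. -/
noncomputable def clampCube (R : ℝ) (y : EuclideanSpace ℝ (Fin n)) : EuclideanSpace ℝ (Fin n) :=
  WithLp.toLp 2 fun i => max (-R) (min R (y i))

/-- Composing with the retraction makes the vector field globally Lipschitz and bounded without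
changing it where the arcs live. -/
lemma lipschitzWith_clampCube (R : ℝ) :
    LipschitzWith 1 (clampCube R : EuclideanSpace ℝ (Fin n) → _) := by
  refine LipschitzWith.of_dist_le_mul fun y z => ?_
  rw [NNReal.coe_one, one_mul, EuclideanSpace.dist_eq, EuclideanSpace.dist_eq]
  refine Real.sqrt_le_sqrt (Finset.sum_le_sum fun i _ => ?_)
  refine pow_le_pow_left₀ dist_nonneg ?_ 2
  simp only [clampCube, Real.dist_eq]
  refine (abs_max_sub_max_le_max _ _ _ _).trans ?_
  simpa using abs_min_sub_min_le_max R (y i) R (z i)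

lemma clampCube_eq_self {R : ℝ} {y : EuclideanSpace ℝ (Fin n)} (hy : ‖y‖ ≤ R) :
    clampCube R y = y := by
  ext i
  have := abs_le.1 ((PiLp.norm_apply_le y i).trans hy)
  simp [clampCube, this.1, this.2]

lemma exists_norm_clampCube_le (n : ℕ) {R : ℝ} (hR : 0 ≤ R) :
    ∃ M : ℝ, 0 ≤ M ∧ ∀ y : EuclideanSpace ℝ (Fin n), ‖clampCube R y‖ ≤ M := by
  refine ⟨√(∑ _i : Fin n, R ^ 2), Real.sqrt_nonneg _, fun y => ?_⟩
  rw [EuclideanSpace.norm_eq]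
  refine Real.sqrt_le_sqrt (Finset.sum_le_sum fun i _ => ?_)
  refine pow_le_pow_left₀ (norm_nonneg _) ?_ 2
  rw [Real.norm_eq_abs, abs_le]
  exact ⟨le_max_left _ _, max_le (by linarith) (min_le_left _ _)⟩

/-- Global backward existence for a bounded, globally Lipschitz vector field. -/
lemma exists_backward_solution {V : Type*} [NormedAddCommGroup V] [NormedSpace ℝ V]
    [CompleteSpace V] {g : ℝ → V → V} {t : ℝ} (ht : 0 ≤ t) {L M : ℝ≥0}
    (hL : ∀ s ∈ Icc 0 t, LipschitzWith L (g s)) (hc : ∀ y, ContinuousOn (g · y) (Icc 0 t))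
    (hM : ∀ s ∈ Icc 0 t, ∀ y, ‖g s y‖ ≤ M) (y : V) :
    ∃ w : ℝ → V, w t = y ∧ AbsolutelyContinuousOnInterval w 0 t ∧
      ∀ s ∈ Ioo 0 t, HasDerivAt w (g s (w s)) s := by
  -- The initial time is the right endpoint; at speed at most `M`, a ball of radius `M t` cannot be
  -- left, so the solution covers all of `[0, t]`.
  have hpl : IsPicardLindelof g (⟨t, ht, le_rfl⟩ : Icc 0 t) y (M * t.toNNReal) 0 M L :=
    { lipschitzOnWith := fun s hs => (hL s hs).lipschitzOnWith
      continuousOn := fun z _ => hc z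
      norm_le := fun s hs z _ => hM s hs z
      mul_max_le := by simp [ht] }
  obtain ⟨w, hwt, hw⟩ := hpl.exists_eq_forall_mem_Icc_hasDerivWithinAt₀
  refine ⟨w, hwt, ?_, fun s hs =>
    (hw s (Ioo_subset_Icc_self hs)).hasDerivAt (Icc_mem_nhds hs.1 hs.2)⟩
  have hlip : LipschitzOnWith M w (Icc 0 t) :=
    (convex_Icc 0 t).lipschitzOnWith_of_nnnorm_hasDerivWithin_le hw fun s hs => hM s hs _
  rw [← uIcc_of_le ht] at hlip
  exact hlip.absolutelyContinuousOnInterval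

variable {F : EuclideanSpace ℝ (Fin n) → Set (EuclideanSpace ℝ (Fin n))}
  {x p : ℝ → EuclideanSpace ℝ (Fin n)}

lemma IsHamiltonianArc.restrict {T t : ℝ} (h : IsHamiltonianArc F T x p) (ht : t ∈ Icc 0 T) :
    IsHamiltonianArc F t x p := by
  have hsub : Icc 0 t ⊆ Icc 0 T := Icc_subset_Icc_right ht.2
  have hu : uIcc 0 t ⊆ uIcc 0 T := by rwa [uIcc_of_le ht.1, uIcc_of_le (ht.1.trans ht.2)]
  exact ⟨h.1.mono hu, h.2.1.mono hu, ae_restrict_of_ae_restrict_of_subset hsub h.2.2⟩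

/-- The adjoint arc of a Hamiltonian arc that vanishes at some time vanishes from then on. -/
lemma IsHamiltonianArc.eq_zero_of_le (hF : AssumptionF F) {T : ℝ} (h : IsHamiltonianArc F T x p)
    {s t : ℝ} (hs : 0 ≤ s) (hst : s ≤ t) (htT : t ≤ T) (hps : p s = 0) : p t = 0 := by
  have hT : 0 ≤ T := hs.trans (hst.trans htT)
  obtain ⟨R, hR⟩ := h.1.exists_bound
  rw [uIcc_of_le hT] at hR
  obtain ⟨L, hL, hlip⟩ := hF.exists_lipschitz_maxHam (R + 1)
  have hsub : Icc s t ⊆ Icc 0 T := Icc_subset_Icc hs htT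
  have hac : AbsolutelyContinuousOnInterval p s t :=
    h.2.1.mono (by rwa [uIcc_of_le hst, uIcc_of_le hT])
  have hae := ae_restrict_of_ae_restrict_of_subset hsub h.2.2
  have := (absolutelyContinuous_gronwall (K := L) hst hac (by
    filter_upwards [hae, ae_restrict_mem measurableSet_Icc] with r hr hrm
    obtain ⟨v, w, -, hw, -, hξ⟩ := hr
    refine ⟨w, hw, ?_⟩
    have hx : x r ∈ Metric.ball 0 (R + 1) := by
      rw [mem_ball_zero_iff]; linarith [hR r (hsub hrm)]
    have := norm_le_of_mem_clarkeGradient (mul_nonneg hL.le (norm_nonneg (p r)))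
      Metric.isOpen_ball hx (fun y hy z hz => hlip y hy z hz (p r)) hξ
    rwa [norm_neg] at this)).1
  rw [hps, norm_zero, zero_pow two_ne_zero, mul_zero] at this
  exact norm_eq_zero.1 (pow_eq_zero_iff two_ne_zero |>.1 (le_antisymm this (by positivity)))

/-- Solving `ẏ = ∇_p H(y, p(s))` backward from points near `x t` gives trajectories that stay close
to `x`. -/
lemma IsHamiltonianArc.exists_nearby_trajectory (hF : AssumptionF F) (hH : AssumptionH F) {t : ℝ}
    (ht : 0 ≤ t) (h : IsHamiltonianArc F t x p) (hp : ∀ s ∈ Icc 0 t, p s ≠ 0) :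
    ∃ δ > 0, ∃ C R : ℝ, 0 ≤ C ∧ (∀ s ∈ Icc 0 t, ‖x s‖ ≤ R) ∧ ∀ y, ‖y - x t‖ < δ →
      ∃ w : ℝ → EuclideanSpace ℝ (Fin n), w t = y ∧ IsTrajectory F t (w 0) w ∧
        (∀ s ∈ Icc 0 t, ‖w s - x s‖ ≤ C * ‖y - x t‖ ∧ ‖w s‖ ≤ R) ∧
        ∀ s ∈ Ioo 0 t, ∃ v, HasDerivAt w v s ∧ ⟪v, p s⟫ = maxHam F (w s) (p s) := by
  obtain ⟨R₀, hR₀⟩ := h.1.exists_bound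
  rw [uIcc_of_le ht] at hR₀
  have hR₀n : 0 ≤ R₀ := (norm_nonneg _).trans (hR₀ 0 ⟨le_rfl, ht⟩)
  set R := R₀ + 1 with hRdef
  obtain ⟨M, hM, hMc⟩ := exists_norm_clampCube_le n (R := R) (by linarith)
  obtain ⟨L, hL⟩ := hH.gradient_lipschitz (M + 1) (by linarith)
  obtain ⟨γ, hγ, hg⟩ := hF.growth
  have hmem : ∀ y : EuclideanSpace ℝ (Fin n), clampCube R y ∈ Metric.ball 0 (M + 1) := fun y => by
    rw [mem_ball_zero_iff]; linarith [hMc y]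
  set G : EuclideanSpace ℝ (Fin n) → EuclideanSpace ℝ (Fin n) → EuclideanSpace ℝ (Fin n) :=
    fun z q => ∇ (fun q => maxHam F z q) q with hG
  have hGF : ∀ z, ∀ s ∈ Icc 0 t, G z (p s) ∈ F z ∧ ⟪G z (p s), p s⟫ = maxHam F z (p s) :=
    fun z s hs => hF.gradient_mem (hH.hasGradientAt z (hp s hs))
  have hlip : ∀ s ∈ Icc 0 t, LipschitzWith L fun y => G (clampCube R y) (p s) := fun s hs => by
    have := (hL (p s) (hp s hs)).comp (lipschitzWith_clampCube (n := n) R).lipschitzOnWith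
      (s := univ) fun y _ => hmem y
    rw [mul_one, lipschitzOnWith_univ] at this
    exact this
  have hcont : ∀ y, ContinuousOn (fun s => G (clampCube R y) (p s)) (Icc 0 t) := fun y => by
    have hpc := h.2.1.continuousOn
    rw [uIcc_of_le ht] at hpc
    exact (continuousOn_gradient_maxHam hF hH _).comp hpc hp
  have hbd : ∀ s ∈ Icc 0 t, ∀ y, ‖G (clampCube R y) (p s)‖ ≤
      ((⟨γ * (1 + M), by positivity⟩ : ℝ≥0) : ℝ) := fun s hs y =>
    (hg _ _ (hGF _ s hs).1).trans (by
      have := hMc y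
      show γ * (1 + ‖clampCube R y‖) ≤ γ * (1 + M)
      gcongr)
  -- This `δ` keeps the Grönwall deviation at most `1`, hence `‖w s‖ ≤ R₀ + 1 = R`, where the clamp
  -- is inactive.
  refine ⟨Real.exp (-(L * t)), Real.exp_pos _, Real.exp (L * t), R, (Real.exp_pos _).le,
    fun s hs => by linarith [hR₀ s hs], fun y hy => ?_⟩
  obtain ⟨w, hwt, hwac, hw⟩ := exists_backward_solution ht hlip hcont hbd y
  have hclose : ∀ s ∈ Icc 0 t, ‖w s - x s‖ ≤ Real.exp (L * t) * ‖y - x t‖ := fun s hs => by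
    have hsub : Icc s t ⊆ Icc 0 t := Icc_subset_Icc_left hs.1
    have hac : AbsolutelyContinuousOnInterval (fun r => w r - x r) s t :=
      (hwac.fun_sub h.1).mono (by rwa [uIcc_of_le hs.2, uIcc_of_le ht])
    have hne : ∀ᵐ r ∂(volume.restrict (Icc s t)), r ≠ 0 ∧ r ≠ t := by
      refine ae_restrict_of_ae (eventually_and.2 ⟨?_, ?_⟩) <;> simp [ae_iff, measure_singleton]
    have hgr := (absolutelyContinuous_gronwall (K := L) hs.2 hac (by
      filter_upwards [ae_restrict_of_ae_restrict_of_subset hsub h.2.2, hne,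
        ae_restrict_mem measurableSet_Icc] with r hr hr0 hrm
      obtain ⟨v, -, hv, -, hgrad, -⟩ := hr
      have hr1 := hsub hrm
      refine ⟨_, (hw r ⟨hr1.1.lt_of_ne' hr0.1, hr1.2.lt_of_ne hr0.2⟩).fun_sub hv, ?_⟩
      have e : v = G (clampCube R (x r)) (p r) := by
        rw [clampCube_eq_self (by linarith [hR₀ r hr1])]
        exact hgrad.gradient.symm
      rw [e]
      exact (hlip r hr1).norm_sub_le (w r) (x r))).2
    rw [hwt] at hgr
    refine le_of_sq_le_sq ?_ (by positivity)
    refine hgr.trans ?_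
    rw [mul_pow, ← Real.exp_nat_mul]
    refine mul_le_mul_of_nonneg_right (Real.exp_le_exp.2 ?_) (by positivity)
    have : (L : ℝ) * (t - s) ≤ L * t :=
      mul_le_mul_of_nonneg_left (by linarith [hs.1]) L.coe_nonneg
    push_cast
    linarith
  have hsmall : Real.exp (L * t) * ‖y - x t‖ ≤ 1 := by
    calc Real.exp (L * t) * ‖y - x t‖ ≤ Real.exp (L * t) * Real.exp (-(L * t)) := by gcongr
      _ = 1 := by rw [← Real.exp_add]; simp
  have hwR : ∀ s ∈ Icc 0 t, ‖w s‖ ≤ R := fun s hs => by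
    have h1 := norm_add_le (w s - x s) (x s)
    rw [sub_add_cancel] at h1
    linarith [hclose s hs, hR₀ s hs]
  have hwd : ∀ s ∈ Ioo 0 t, HasDerivAt w (G (w s) (p s)) s := fun s hs => by
    have := hw s hs
    rwa [clampCube_eq_self (hwR s (Ioo_subset_Icc_self hs))] at this
  refine ⟨w, hwt, ⟨hwac, rfl, ?_⟩, fun s hs => ⟨hclose s hs, hwR s hs⟩, fun s hs =>
    ⟨_, hwd s hs, (hGF _ s (Ioo_subset_Icc_self hs)).2⟩⟩
  rw [← restrict_Ioo_eq_restrict_Icc]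
  filter_upwards [ae_restrict_mem measurableSet_Ioo] with s hs
  exact ⟨_, (hGF _ s (Ioo_subset_Icc_self hs)).1, hwd s hs⟩

/-- Points near `x t` are endpoints of trajectories along which the pairing with the adjoint arc
grows at most quadratically. -/
lemma IsHamiltonianArc.exists_backward_trajectory (hF : AssumptionF F) (hH : AssumptionH F) {t : ℝ}
    (ht : 0 ≤ t) (h : IsHamiltonianArc F t x p) (hp : ∀ s ∈ Icc 0 t, p s ≠ 0) :
    ∃ δ > 0, ∃ C D : ℝ, 0 ≤ C ∧ 0 ≤ D ∧ ∀ y, ‖y - x t‖ < δ →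
      ∃ w : ℝ → EuclideanSpace ℝ (Fin n), w t = y ∧ IsTrajectory F t (w 0) w ∧
        ‖w 0 - x 0‖ ≤ C * ‖y - x t‖ ∧
        ⟪-p t, y - x t⟫ ≤ ⟪-p 0, w 0 - x 0⟫ + D * ‖y - x t‖ ^ 2 := by
  obtain ⟨δ, hδ, C, R, hC, hxR, H⟩ := h.exists_nearby_trajectory hF hH ht hp
  have hR : 0 ≤ R := (norm_nonneg _).trans (hxR 0 ⟨le_rfl, ht⟩)
  obtain ⟨c, hc, hsc⟩ := hH.semiconvex (R + 1) (by linarith)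
  obtain ⟨P, hP⟩ := h.2.1.exists_bound
  rw [uIcc_of_le ht] at hP
  have hPn : 0 ≤ P := (norm_nonneg _).trans (hP 0 ⟨le_rfl, ht⟩)
  refine ⟨δ, hδ, C, c * P / 2 * C ^ 2 * t, hC, by positivity, fun y hy => ?_⟩
  obtain ⟨w, hwt, hwtraj, hwx, hwd⟩ := H y hy
  refine ⟨w, hwt, hwtraj, (hwx 0 ⟨le_rfl, ht⟩).1, ?_⟩
  -- Bounds the derivative of `⟪-p, w - x⟫` by semiconvexity (`h1`) and the maximality of both
  -- velocities (`h3`).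
  have hφ := absolutelyContinuous_sub_le (M := c * P / 2 * (C * ‖y - x t‖) ^ 2) ht
    (absolutelyContinuous_inner h.2.1.fun_neg (hwtraj.1.fun_sub h.1)) (by
      have hae := h.2.2
      rw [← restrict_Ioo_eq_restrict_Icc] at hae ⊢
      filter_upwards [hae, ae_restrict_mem measurableSet_Ioo] with s hs hsm
      obtain ⟨v, q, hv, hq, hgrad, hξ⟩ := hs
      obtain ⟨u, hu, hup⟩ := hwd s hsm
      have hs' := Ioo_subset_Icc_self hsm
      refine ⟨_, hq.fun_neg.inner ℝ (hu.fun_sub hv), ?_⟩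
      have hmem : ∀ z : EuclideanSpace ℝ (Fin n), ‖z‖ ≤ R → z ∈ Metric.ball 0 (R + 1) :=
        fun z hz => by rw [mem_ball_zero_iff]; linarith
      have h1 := maxHam_clarkeGradient_le hsc (hp s hs') (hmem _ (hxR s hs'))
        (hmem _ (hwx s hs').2) hξ
      have h2 : c * ‖p s‖ / 2 * ‖w s - x s‖ ^ 2 ≤ c * P / 2 * (C * ‖y - x t‖) ^ 2 := by
        gcongr
        · exact hP s hs'
        · exact (hwx s hs').1
      have h3 : ⟪-p s, u - v⟫ = maxHam F (x s) (p s) - maxHam F (w s) (p s) := by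
        rw [← hup, ← (hF.gradient_mem hgrad).2, inner_neg_left, inner_sub_right,
          real_inner_comm, real_inner_comm v]
        ring
      rw [h3]
      linarith)
  rw [hwt] at hφ
  linarith

end Backward

/-! ### Propagation of horizontal proximal subgradients -/

section Propagation

lemma mem_horizontalSubdiff_iff {V : Type*} [NormedAddCommGroup V] [InnerProductSpace ℝ V]
    {f : V → EReal} {x v : V} {τ : ℝ} (hτ : f x = τ) :
    v ∈ horizontalSubdiff f x ↔ ∃ σ : ℝ, 0 ≤ σ ∧ ∀ (y : V) (β : ℝ), f y ≤ β →
      ⟪v, y - x⟫ ≤ σ * (‖y - x‖ ^ 2 + (β - τ) ^ 2) := by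
  have hmem : WithLp.toLp 2 (x, τ) ∈ epigraph f := by simp [epigraph, hτ]
  simp only [horizontalSubdiff, proximalNormalCone, mem_ofPred_eq, hτ, EReal.toReal_coe, ne_eq,
    EReal.coe_ne_top, EReal.coe_ne_bot, not_false_eq_true, true_and, hmem]
  refine exists_congr fun σ => and_congr_right fun _ => ⟨fun h y β hy => ?_, fun h z hz => ?_⟩
  · simpa [WithLp.prod_inner_apply, WithLp.prod_norm_sq_eq_of_L2] using
      h (WithLp.toLp 2 (y, β)) hy
  · simpa [WithLp.prod_inner_apply, WithLp.prod_norm_sq_eq_of_L2] using h z.fst z.snd hz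

variable {n : ℕ} {F : EuclideanSpace ℝ (Fin n) → Set (EuclideanSpace ℝ (Fin n))}
  {K : Set (EuclideanSpace ℝ (Fin n))} {x₀ : EuclideanSpace ℝ (Fin n)}
  {x p : ℝ → EuclideanSpace ℝ (Fin n)}

lemma neg_mem_horizontalSubdiff (hF : AssumptionF F) (hH : AssumptionH F)
    (hx₀ : x₀ ∈ reachable F K) (hx : IsOptimalTrajectory F K x₀ x)
    (hxp : IsHamiltonianArc F (minTime F K x₀).toReal x p)
    (hp : -p 0 ∈ horizontalSubdiff (minTime F K) x₀) {t : ℝ}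
    (ht : t ∈ Icc 0 (minTime F K x₀).toReal) :
    -p t ∈ horizontalSubdiff (minTime F K) (x t) := by
  rw [mem_horizontalSubdiff_iff (hx.minTime_eq hx₀ ht)]
  rw [mem_horizontalSubdiff_iff (minTime_toReal hx₀).symm] at hp
  set T := (minTime F K x₀).toReal
  obtain ⟨σ, hσ, H⟩ := hp
  by_cases hpt : p t = 0
  · exact ⟨0, le_rfl, fun y β _ => by simp [hpt]⟩
  have hps : ∀ s ∈ Icc 0 t, p s ≠ 0 := fun s hs h0 =>
    hpt (hxp.eq_zero_of_le hF hs.1 hs.2 ht.2 h0)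
  obtain ⟨δ, hδ, C, D, hC, hD, hw⟩ :=
    (hxp.restrict ht).exists_backward_trajectory hF hH ht.1 hps
  have hA : 0 ≤ σ * (C ^ 2 + 1) := by positivity
  have hB : 0 ≤ ‖p t‖ / δ := by positivity
  -- The first two terms serve `y` within `δ` of `x t`; the last covers distant `y` by
  -- Cauchy–Schwarz.
  refine ⟨σ * (C ^ 2 + 1) + D + ‖p t‖ / δ, by positivity, fun y β hy => ?_⟩
  rcases lt_or_ge ‖y - x t‖ δ with hlt | hge
  · obtain ⟨w, hwt, hwtraj, hw0, hwp⟩ := hw y hlt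
    rw [← hwt] at hy
    have h1 := H (w 0) (t + β) (minTime_le_add_of_le ht.1 hwtraj hy)
    rw [hx.1.2.1] at hw0 hwp
    have h2 : ‖w 0 - x₀‖ ^ 2 ≤ C ^ 2 * ‖y - x t‖ ^ 2 := by
      rw [← mul_pow]; gcongr
    have e : t + β - T = β - (T - t) := by ring
    rw [e] at h1
    set a := ‖y - x t‖ ^ 2
    set b := (β - (T - t)) ^ 2
    have ha : 0 ≤ a := by positivity
    have hb : 0 ≤ b := by positivity
    calc ⟪-p t, y - x t⟫ ≤ σ * (‖w 0 - x₀‖ ^ 2 + b) + D * a := by linarith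
      _ ≤ σ * (C ^ 2 * a + b) + D * a := by gcongr
      _ ≤ σ * (C ^ 2 + 1) * (a + b) + D * (a + b) + ‖p t‖ / δ * (a + b) := by
        have h3 : C ^ 2 * a + b ≤ (C ^ 2 + 1) * (a + b) := by
          linarith [mul_nonneg (sq_nonneg C) hb]
        have h4 : D * a ≤ D * (a + b) := by gcongr; linarith
        have h5 : 0 ≤ ‖p t‖ / δ * (a + b) := by positivity
        have h6 := mul_le_mul_of_nonneg_left h3 hσ
        linarith
      _ = _ := by ring
  · have h1 : ⟪-p t, y - x t⟫ ≤ ‖p t‖ / δ * ‖y - x t‖ ^ 2 := by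
      refine (real_inner_le_norm _ _).trans ?_
      rw [norm_neg, div_mul_eq_mul_div, le_div_iff₀ hδ, mul_assoc, pow_two]
      gcongr
    refine h1.trans ?_
    gcongr
    · linarith
    · linarith [sq_nonneg (β - (T - t))]

lemma maxHam_eq_zero_of_hasDerivAt (hF : AssumptionF F)
    (hx₀ : x₀ ∈ reachable F K) (hx : IsOptimalTrajectory F K x₀ x) {t : ℝ}
    (ht : t ∈ Ioo 0 (minTime F K x₀).toReal) {q v : EuclideanSpace ℝ (Fin n)}
    (hq : -q ∈ horizontalSubdiff (minTime F K) (x t)) (hv : HasDerivAt x v t)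
    (hgrad : HasGradientAt (fun q => maxHam F (x t) q) v q) : maxHam F (x t) q = 0 := by
  have ht' := Ioo_subset_Icc_self ht
  rw [mem_horizontalSubdiff_iff (hx.minTime_eq hx₀ ht')] at hq
  obtain ⟨σ, hσ, H⟩ := hq
  -- Along `x` this expression is at most `0`, with equality at `s = t`. Since `t` is interior, both
  -- time directions count, so the derivative vanishes; the quadratic terms contribute nothing to
  -- it.
  have hmax : IsLocalMax
      (fun s => ⟪-q, x s - x t⟫ - σ * (‖x s - x t‖ ^ 2 + (s - t) ^ 2)) t := by
    filter_upwards [Icc_mem_nhds ht.1 ht.2] with s hs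
    have := H (x s) _ (hx.minTime_eq hx₀ hs).le
    rw [show (minTime F K x₀).toReal - s - ((minTime F K x₀).toReal - t) = -(s - t) by ring,
      neg_sq] at this
    simpa using this
  have hsub : HasDerivAt (fun s => x s - x t) v t := hv.sub_const _
  have hin : HasDerivAt (fun s => ⟪-q, x s - x t⟫) _ t := (hasDerivAt_const t (-q)).inner ℝ hsub
  have hsq : HasDerivAt (fun s => (s - t) ^ 2) _ t := ((hasDerivAt_id t).sub_const t).fun_pow 2
  have hd := hin.fun_sub ((hsub.norm_sq.fun_add hsq).const_mul σ)
  have := hmax.hasDerivAt_eq_zero hd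
  simp only [sub_self, inner_neg_left, inner_zero_left, inner_zero_right, mul_zero, zero_mul,
    Nat.cast_ofNat, Nat.add_one_sub_one, pow_one, id_eq, add_zero, sub_zero,
    neg_eq_zero] at this
  rw [← (hF.gradient_mem hgrad).2, real_inner_comm]
  exact this

end Propagation

end MinTime

theorem mainTheorem10 {n : ℕ}
    (F : EuclideanSpace ℝ (Fin n) → Set (EuclideanSpace ℝ (Fin n)))
    (K : Set (EuclideanSpace ℝ (Fin n)))
    (hF : MinTime.AssumptionF F) (hH : MinTime.AssumptionH F) (hK : IsClosed K)
    (x₀ : EuclideanSpace ℝ (Fin n)) (hx₀ : x₀ ∈ MinTime.reachable F K \ K)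
    (x p : ℝ → EuclideanSpace ℝ (Fin n))
    (hx : MinTime.IsOptimalTrajectory F K x₀ x)
    (hxp : MinTime.IsHamiltonianArc F (MinTime.minTime F K x₀).toReal x p)
    (hp : -p 0 ∈ MinTime.horizontalSubdiff (MinTime.minTime F K) x₀) :
    ∀ t ∈ Set.Icc (0 : ℝ) (MinTime.minTime F K x₀).toReal,
      -p t ∈ MinTime.horizontalSubdiff (MinTime.minTime F K) (x t) ∧
        MinTime.minHam F (x t) (-p t) = 0 := by
  have hsub := fun t (ht : t ∈ Icc 0 (MinTime.minTime F K x₀).toReal) =>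
    MinTime.neg_mem_horizontalSubdiff hF hH hx₀.1 hx hxp hp ht
  refine fun t ht => ⟨hsub t ht, ?_⟩
  -- A nondegenerate interval is needed for an almost everywhere identity between continuous
  -- functions to hold everywhere, endpoints included.
  have hT : (0 : ℝ) ≠ (MinTime.minTime F K x₀).toReal := fun h => by
    have h1 := hx.2
    rw [← h, hx.1.2.1] at h1
    exact hx₀.2 h1
  have hT' : 0 ≤ (MinTime.minTime F K x₀).toReal := ht.1.trans ht.2
  have hcont : ContinuousOn (fun s => MinTime.maxHam F (x s) (p s))
      (Icc 0 (MinTime.minTime F K x₀).toReal) := by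
    have hc := hxp.1.continuousOn.prodMk hxp.2.1.continuousOn
    rw [uIcc_of_le hT'] at hc
    exact Continuous.comp_continuousOn (g := fun z : EuclideanSpace ℝ (Fin n) ×
      EuclideanSpace ℝ (Fin n) => MinTime.maxHam F z.1 z.2) (f := fun s => (x s, p s))
      hF.continuous_maxHam hc
  have hzero := MeasureTheory.Measure.eqOn_Icc_of_ae_eq volume hT (g := fun _ => (0 : ℝ)) (by
    have hae := hxp.2.2
    rw [← restrict_Ioo_eq_restrict_Icc] at hae ⊢
    filter_upwards [hae, ae_restrict_mem measurableSet_Ioo] with s hs hsm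
    obtain ⟨v, w, hv, -, hgrad, -⟩ := hs
    exact MinTime.maxHam_eq_zero_of_hasDerivAt hF hx₀.1 hx hsm
      (hsub s (Ioo_subset_Icc_self hsm)) hv hgrad) hcont continuousOn_const
  rw [MinTime.minHam_neg, neg_eq_zero]
  exact hzero ht
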